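/- Equip the Cantor space $2^\omega$ of infinite binary sequences with the metric given by $d(x,x)=0$ and $d(x,y)=2^{-n}$ for $x\neq y$, where $n$ is least such that $x(n)\neq y(n)$. Let $Q$ be a locally countable Borel quasi-order on $2^\omega$, that is, a reflexive and transitive relation $\leq_Q$ on $2^\omega$ that is a Borel subset of $2^\omega\times 2^\omega$ and such that $\{x\in 2^\omega : x\leq_Q y\}$ is countable for every $y\in 2^\omega$. Then there is a closed set $B\subseteq 2^\omega$ of Hausdorff dimension $1$ (with respect to $d$) that is a $Q$-antichain, i.e. $x\not\leq_Q y$ for all distinct $x,y\in B$. -/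

import Mathlib

/-- The metric on the Cantor space `2^ω`, realized as `ℕ → Bool`: for `x ≠ y`, `dist x y = 2⁻ⁿ`
where `n` is the least index with `x n ≠ y n`. Its topology is the product topology. -/
noncomputable instance cantorMetricSpace : MetricSpace (ℕ → Bool) :=
  PiNat.metricSpaceOfDiscreteUniformity (fun _ => rfl)

theorem cantor_dist_eq {x y : ℕ → Bool} {n : ℕ} (hn : x n ≠ y n) (hlt : ∀ i < n, x i = y i) :
    dist x y = (2 : ℝ)⁻¹ ^ n := by
  have hxy : x ≠ y := fun h => hn (congrFun h n)
  have h1 : PiNat.firstDiff x y = n := by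
    apply le_antisymm
    · by_contra! h
      exact hn (PiNat.apply_eq_of_lt_firstDiff h)
    · by_contra! h
      exact PiNat.apply_firstDiff_ne hxy (hlt _ h)
  have h2 := PiNat.dist_eq_of_ne hxy
  rw [h1, one_div] at h2
  exact h2

/-- A locally countable Borel quasi-order on the Cantor space; `Q x y` is read `x ≤_Q y`. -/
structure IsLocallyCountableBorelQuasiOrder (Q : (ℕ → Bool) → (ℕ → Bool) → Prop) : Prop where
  refl : ∀ x, Q x x
  trans : ∀ x y z, Q x y → Q y z → Q x z
  borel : MeasurableSet {p : (ℕ → Bool) × (ℕ → Bool) | Q p.1 p.2}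
  locallyCountable : ∀ y, {x | Q x y}.Countable

/-! Fix an infinite set `D` of positions of density zero (the squares). For a random table `ω` of
fair bits, `scramble D ω` keeps the bits of `z` off `D` and fills each position in `D` with an entry
of `ω` indexed by the earlier bits off `D`. The coin measure pushed forward gives cylinders of
length `n` mass at most `2^-(n - o(n))`, so by mass distribution every set of positive mass has
dimension 1.

The randomness destroys comparabilities. Fix `z` and the entries of `ω` that `z` reads; then `y =
scramble D ω z` is determined and has only countably many `x` below it. If `x` differs from `z` off
`D`, then past that difference `x` reads infinitely many fresh entries, so it lies in the range with
probability 0 (`coinMeasure_scrambleBad_section`). By Fubini some `ω` is good for almost every `z`;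
the image of a compact set of good `z` of positive measure is the antichain. The bad set is a
projection, hence analytic, so Fubini needs analytic sets to be null measurable. -/

open MeasureTheory Set Filter Topology Metric
open scoped ENNReal NNReal

/-! ### Analytic sets, null sections and independent resampling -/

/-- An analytic set is inner regular for compact sets with respect to any finite measure. -/
theorem MeasureTheory.AnalyticSet.exists_isCompact_le_measure {X : Type*} [TopologicalSpace X]
    [MeasurableSpace X] {μ : Measure X} [μ.OuterRegular] {A : Set X}
    (hA : AnalyticSet A) {c : ℝ≥0∞} (hc : c < μ A) :
    ∃ K ⊆ A, IsCompact K ∧ c ≤ μ K := by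
  rw [AnalyticSet] at hA
  rcases hA with rfl | ⟨f, hf, rfl⟩
  · simp at hc
  -- Bound the coordinates of Baire space one at a time, each bound large enough that the image
  -- keeps measure above `c`; the limiting box is compact.
  let S : ∀ n : ℕ, (ℕ → ℕ) → Set (ℕ → ℕ) := fun n k => {x | ∀ i < n, x i ≤ k i}
  have step : ∀ (n : ℕ) (k : ℕ → ℕ), c < μ (f '' S n k) →
      ∃ m, c < μ (f '' S (n + 1) (Function.update k n m)) := by
    intro n k h
    have hU : f '' S n k = ⋃ m, f '' S (n + 1) (Function.update k n m) := by
      rw [← image_iUnion]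
      congr 1
      ext x
      simp only [S, mem_ofPred_eq, mem_iUnion]
      constructor
      · intro hx
        refine ⟨x n, fun i hi => ?_⟩
        rcases Nat.lt_succ_iff_lt_or_eq.1 hi with hi | rfl
        · rw [Function.update_of_ne hi.ne]; exact hx i hi
        · simp
      · rintro ⟨m, hm⟩ i hi
        have := hm i (by omega)
        rwa [Function.update_of_ne hi.ne] at this
    have hmono : Monotone fun m => f '' S (n + 1) (Function.update k n m) := by
      intro a b hab
      refine image_mono fun x hx i hi => (hx i hi).trans ?_
      rcases eq_or_ne i n with rfl | hin
      · simpa using hab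
      · simp [Function.update_of_ne hin]
    rw [hU, hmono.measure_iUnion] at h
    exact lt_iSup_iff.1 h
  choose! g hg using step
  let K : ℕ → ℕ → ℕ := fun n => Nat.rec (fun _ => 0) (fun n k => Function.update k n (g n k)) n
  have hK1 : ∀ n, K (n + 1) = Function.update (K n) n (g n (K n)) := fun n => rfl
  have hKc : ∀ n, c < μ (f '' S n (K n)) := by
    intro n
    induction n with
    | zero =>
      have : S 0 (K 0) = univ := by ext x; simp [S]
      rwa [this, image_univ]
    | succ n ih => rw [hK1]; exact hg n _ ih
  have hKd : ∀ i n, i < n → K n i = K (i + 1) i := by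
    intro i n hin
    induction n, hin using Nat.le_induction with
    | base => rfl
    | succ n hn ih => rw [hK1, Function.update_of_ne (by omega), ih]
  let k : ℕ → ℕ := fun i => K (i + 1) i
  have hSk : ∀ n, S n (K n) = S n k := by
    intro n
    ext x
    refine forall₂_congr fun i hi => ?_
    rw [hKd i n hi]
  have hcpt : IsCompact (Set.pi univ fun i => Iic (k i)) :=
    isCompact_univ_pi fun i => (finite_Iic (k i)).isCompact
  refine ⟨f '' Set.pi univ fun i => Iic (k i), image_subset_range _ _, hcpt.image hf, ?_⟩
  rw [Set.measure_eq_iInf_isOpen]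
  refine le_iInf₂ fun U hU => le_iInf fun hUo => ?_
  by_contra! hlt
  have hx : ∀ n, ∃ x ∈ S n k, f x ∉ U := by
    intro n
    by_contra! h
    have : f '' S n k ⊆ U := by rintro _ ⟨x, hx, rfl⟩; exact h x hx
    have h2 := hKc n
    rw [hSk] at h2
    exact absurd (h2.trans_le (measure_mono this)) hlt.not_gt
  choose x hxS hxU using hx
  -- Truncating by `k` moves `x n` into the box; its first `n` coordinates are unchanged, so the
  -- limit is the same.
  obtain ⟨z, hz, φ, hφ, hlim⟩ := hcpt.tendsto_subseq
    (x := fun n i => min (x n i) (k i)) (fun n i _ => mem_Iic.2 (min_le_right _ _))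
  have hlim2 : Tendsto (x ∘ φ) atTop (𝓝 z) := by
    rw [tendsto_pi_nhds] at hlim ⊢
    intro i
    refine (hlim i).congr' ?_
    filter_upwards [eventually_gt_atTop i] with n hn
    exact min_eq_left (hxS _ i (hn.trans_le (hφ.id_le n)))
  have := ((hf.tendsto z).comp hlim2).eventually (hUo.mem_nhds (hU (mem_image_of_mem f hz)))
  obtain ⟨n, hn⟩ := this.exists
  exact hxU _ hn

theorem MeasureTheory.AnalyticSet.nullMeasurableSet {X : Type*} [TopologicalSpace X] [T2Space X]
    [MeasurableSpace X] [OpensMeasurableSpace X] {μ : Measure X} [IsFiniteMeasure μ]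
    [μ.OuterRegular] {A : Set X} (hA : AnalyticSet A) : NullMeasurableSet A μ := by
  rcases eq_or_ne (μ A) 0 with h0 | h0
  · exact NullMeasurableSet.of_null h0
  obtain ⟨u, -, hu, hut⟩ := exists_seq_strictMono_tendsto' (pos_iff_ne_zero.2 h0)
  choose K hKA hK hKc using fun n => hA.exists_isCompact_le_measure (hu n).2
  have hT : MeasurableSet (⋃ n, K n) := .iUnion fun n => (hK n).measurableSet
  refine hT.nullMeasurableSet.congr ?_
  refine ae_eq_of_subset_of_measure_ge (iUnion_subset hKA) ?_ hT.nullMeasurableSet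
    (measure_ne_top μ _)
  exact le_of_tendsto' hut fun n => (hKc n).trans (measure_mono (subset_iUnion _ _))

theorem MeasureTheory.Measure.prod_null_of_forall_section_null {X Y : Type*} [MeasurableSpace X]
    [MeasurableSpace Y] {μ : Measure X} {ν : Measure Y} [SFinite μ] [SFinite ν] {s : Set (X × Y)}
    (hs : NullMeasurableSet s (μ.prod ν)) (h : ∀ x, ν (Prod.mk x ⁻¹' s) = 0) :
    μ.prod ν s = 0 := by
  obtain ⟨t, hts, ht, hae⟩ := hs.exists_measurable_subset_ae_eq
  rw [← measure_congr hae, Measure.measure_prod_null ht]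
  exact Eventually.of_forall fun x => measure_mono_null (preimage_mono hts) (h x)

/-- Choosing the coordinates in `S` from one sample and the others from an independent sample
yields a sample of the product measure. -/
theorem MeasureTheory.Measure.measurePreserving_piecewise_infinitePi {ι : Type*} {X : ι → Type*}
    [∀ i, MeasurableSpace (X i)] (μ : ∀ i, Measure (X i)) [∀ i, IsProbabilityMeasure (μ i)]
    (S : Set ι) [DecidablePred (· ∈ S)] :
    MeasurePreserving (fun p : (∀ i, X i) × (∀ i, X i) => S.piecewise p.1 p.2)
      ((infinitePi μ).prod (infinitePi μ)) (infinitePi μ) := by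
  have hm : Measurable (fun p : (∀ i, X i) × (∀ i, X i) => S.piecewise p.1 p.2) := by
    refine measurable_pi_lambda _ fun i => ?_
    by_cases hi : i ∈ S
    · simp only [Set.piecewise, hi, if_true]; fun_prop
    · simp only [Set.piecewise, hi, if_false]; fun_prop
  refine ⟨hm, eq_infinitePi μ fun s t ht => ?_⟩
  rw [map_apply hm (.pi s.countable_toSet fun i _ => ht i)]
  have : (fun p : (∀ i, X i) × (∀ i, X i) => S.piecewise p.1 p.2) ⁻¹' Set.pi s t =
      (Set.pi (s.filter (· ∈ S) : Finset ι) t) ×ˢ (Set.pi (s.filter (· ∉ S) : Finset ι) t) := by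
    ext p
    simp only [mem_preimage, Set.mem_pi, mem_prod, Finset.coe_filter, mem_ofPred_eq]
    constructor
    · intro h
      refine ⟨fun i hi => ?_, fun i hi => ?_⟩
      · simpa [Set.piecewise, hi.2] using h i hi.1
      · simpa [Set.piecewise, hi.2] using h i hi.1
    · rintro ⟨h1, h2⟩ i hi
      by_cases hiS : i ∈ S
      · simpa [Set.piecewise, hiS] using h1 i ⟨hi, hiS⟩
      · simpa [Set.piecewise, hiS] using h2 i ⟨hi, hiS⟩
  rw [this, prod_prod, infinitePi_pi _ fun i _ => ht i, infinitePi_pi _ fun i _ => ht i,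
    Finset.prod_filter_mul_prod_filter_not]

/-! ### Hausdorff dimension in the Cantor space -/

theorem cantor_edist_le {x y : ℕ → Bool} {n : ℕ} (h : ∀ i < n, x i = y i) :
    edist x y ≤ (2 : ℝ≥0∞)⁻¹ ^ n := by
  rcases eq_or_ne x y with rfl | hxy
  · simp
  obtain ⟨m, hm, hlt⟩ : ∃ m, x m ≠ y m ∧ ∀ i < m, x i = y i := by
    classical
    have hex : ∃ m, x m ≠ y m := Function.ne_iff.1 hxy
    exact ⟨Nat.find hex, Nat.find_spec hex, fun i hi => not_not.1 (Nat.find_min hex hi)⟩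
  have hnm : n ≤ m := by by_contra! hc; exact hm (h m hc)
  rw [edist_dist, cantor_dist_eq hm hlt, ENNReal.ofReal_pow (by norm_num),
    ENNReal.ofReal_inv_of_pos (by norm_num), ENNReal.ofReal_ofNat]
  exact pow_le_pow_right_of_le_one' (by norm_num) hnm

theorem dimH_cantor_le_one (s : Set (ℕ → Bool)) : dimH s ≤ 1 := by
  refine (dimH_mono (subset_univ s)).trans ?_
  refine dimH_le_of_hausdorffMeasure_ne_top (d := 1) (ne_top_of_le_ne_top ENNReal.one_ne_top ?_)
  have hd : ∀ n (σ : Fin n → Bool),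
      ediam {x : ℕ → Bool | ∀ i : Fin n, x i = σ i} ≤ (2 : ℝ≥0∞)⁻¹ ^ n := by
    intro n σ
    refine ediam_le fun x hx y hy => cantor_edist_le fun i hi => ?_
    rw [hx ⟨i, hi⟩, hy ⟨i, hi⟩]
  have hcov : ∀ n, (univ : Set (ℕ → Bool)) ⊆
      ⋃ σ : Fin n → Bool, {x : ℕ → Bool | ∀ i : Fin n, x i = σ i} :=
    fun n x _ => mem_iUnion.2 ⟨fun i : Fin n => x i, fun i => rfl⟩
  refine (Measure.hausdorffMeasure_le_liminf_sum (ι := fun n => Fin n → Bool) (l := atTop) ((1 : ℝ≥0) : ℝ) univ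
    (fun n : ℕ => (2 : ℝ≥0∞)⁻¹ ^ n)
    (ENNReal.tendsto_pow_atTop_nhds_zero_of_lt_one (by norm_num))
    (fun (n : ℕ) (σ : Fin n → Bool) => {x : ℕ → Bool | ∀ i : Fin n, x i = σ i})
    (Eventually.of_forall hd) (Eventually.of_forall hcov)).trans ?_
  refine liminf_le_of_le (by isBoundedDefault) fun b hb => ?_
  obtain ⟨n, hn⟩ := hb.exists
  refine hn.trans ?_
  calc ∑ σ : Fin n → Bool, ediam {x : ℕ → Bool | ∀ i : Fin n, x i = σ i} ^ ((1 : ℝ≥0) : ℝ)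
        ≤ ∑ σ : Fin n → Bool, (2 : ℝ≥0∞)⁻¹ ^ n := by
          refine Finset.sum_le_sum fun σ _ => ?_
          simpa using hd n σ
      _ = 1 := by
          simp [← mul_pow, ENNReal.mul_inv_cancel]

/-- Mass distribution principle on the Cantor space. -/
theorem le_dimH_of_measure_cylinder_le {ν : Measure (ℕ → Bool)} {B : Set (ℕ → Bool)}
    (hB : ν B ≠ 0) {s : ℝ≥0} (hs : 0 < s) {N : ℕ}
    (h : ∀ n ≥ N, ∀ x : ℕ → Bool, ν {y | ∀ i < n, y i = x i} ≤ ((2 : ℝ≥0∞)⁻¹ ^ n) ^ (s : ℝ)) :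
    (s : ℝ≥0∞) ≤ dimH B := by
  have hs' : (0 : ℝ) < s := hs
  refine le_dimH_of_hausdorffMeasure_ne_zero fun h0 => hB ?_
  refine le_antisymm (h0 ▸ Measure.le_hausdorffMeasure s ν ((2 : ℝ≥0∞)⁻¹ ^ N) ?_ ?_ B) zero_le
  · exact ENNReal.pow_pos (by norm_num) N
  intro t ht
  rcases t.eq_empty_or_nonempty with rfl | ⟨x, hx⟩
  · simp
  by_cases hsub : ∀ n, ∀ y ∈ t, y n = x n
  · have hle : ∀ n ≥ N, ν t ≤ ((2 : ℝ≥0∞)⁻¹ ^ n) ^ (s : ℝ) := fun n hn =>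
      (measure_mono (t := {y | ∀ i < n, y i = x i}) fun y hy i _ => hsub i y hy).trans (h n hn x)
    have hlim : Tendsto (fun n : ℕ => ((2 : ℝ≥0∞)⁻¹ ^ n) ^ (s : ℝ)) atTop (𝓝 0) := by
      have := (ENNReal.tendsto_pow_atTop_nhds_zero_of_lt_one
        (r := (2 : ℝ≥0∞)⁻¹) (by norm_num)).ennrpow_const (s : ℝ)
      rwa [ENNReal.zero_rpow_of_pos hs'] at this
    have : ν t ≤ 0 := ge_of_tendsto hlim (eventually_atTop.2 ⟨N, hle⟩)
    exact this.trans zero_le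
  -- At the first index `n` where `t` is not constant, `t` lies in a cylinder of length `n` and has
  -- diameter at least `2⁻ⁿ`.
  · push Not at hsub
    classical
    obtain ⟨y, hy, hne⟩ := Nat.find_spec hsub
    have hmin : ∀ i < Nat.find hsub, ∀ y ∈ t, y i = x i := fun i hi => by
      simpa using Nat.find_min hsub hi
    set n := Nat.find hsub
    have hdiam : (2 : ℝ≥0∞)⁻¹ ^ n ≤ ediam t := by
      refine le_trans (le_of_eq ?_) (edist_le_ediam_of_mem hy hx)
      rw [edist_dist, cantor_dist_eq hne fun i hi => hmin i hi y hy,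
        ENNReal.ofReal_pow (by norm_num), ENNReal.ofReal_inv_of_pos (by norm_num),
        ENNReal.ofReal_ofNat]
    have hn : N ≤ n := by
      by_contra! hc
      have h2 := hdiam.trans ht
      rw [← ENNReal.inv_pow, ← ENNReal.inv_pow, ENNReal.inv_le_inv] at h2
      have h3 : 2 ^ N ≤ 2 ^ n := by exact_mod_cast h2
      exact absurd ((Nat.pow_le_pow_iff_right (by norm_num)).1 h3) (by omega)
    calc ν t ≤ ν {y | ∀ i < n, y i = x i} := measure_mono fun y hy i hi => hmin i hi y hy
      _ ≤ _ := h n hn x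
      _ ≤ _ := ENNReal.rpow_le_rpow hdiam hs'.le

/-! ### Coin tossing and the scrambling map -/

/-- The law of independent fair coin tosses indexed by `ι`. -/
noncomputable def coinMeasure (ι : Type*) : Measure (ι → Bool) :=
  Measure.infinitePi fun _ => (PMF.uniformOfFintype Bool).toMeasure

instance {ι : Type*} [Countable ι] : PolishSpace (ι → Bool) := by
  let := TopologicalSpace.metrizableSpaceMetric (ι → Bool)
  infer_instance

instance (ι : Type*) : IsProbabilityMeasure (coinMeasure ι) := by
  unfold coinMeasure; infer_instance

theorem coinMeasure_agree {ι : Type*} (s : Finset ι) (x : ι → Bool) :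
    coinMeasure ι {y | ∀ i ∈ s, y i = x i} = (2 : ℝ≥0∞)⁻¹ ^ s.card := by
  have : {y : ι → Bool | ∀ i ∈ s, y i = x i} = Set.pi s fun i => {x i} := by
    ext y; simp
  rw [this, coinMeasure, Measure.infinitePi_pi _ fun i _ => measurableSet_singleton _]
  simp

theorem coinMeasure_agree_infinite {ι : Type*} {S : Set ι} (hS : S.Infinite) (x : ι → Bool) :
    coinMeasure ι {y | ∀ i ∈ S, y i = x i} = 0 := by
  refine le_antisymm (ge_of_tendsto' (ENNReal.tendsto_pow_atTop_nhds_zero_of_lt_one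
    (r := (2 : ℝ≥0∞)⁻¹) (by norm_num)) fun n => ?_) zero_le
  obtain ⟨s, hs, rfl⟩ := hS.exists_subset_card_eq n
  rw [← coinMeasure_agree s x]
  exact measure_mono fun y hy i hi => hy i (hs hi)

section Scramble

variable (D : Set ℕ) [DecidablePred (· ∈ D)]

/-- A code for the bits of `z` at the positions below `n` outside `D`. -/
def prefixCode (z : ℕ → Bool) (n : ℕ) : ℕ × Finset ℕ :=
  (n, (Finset.range n).filter fun i => i ∉ D ∧ z i = true)

/-- Replace each bit of `z` at a position in `D` by a bit of `ω` that is looked up according to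
the preceding bits of `z` outside `D`. -/
def scramble (ω : ℕ × Finset ℕ → Bool) (z : ℕ → Bool) : ℕ → Bool :=
  fun n => if n ∈ D then ω (prefixCode D z n) else z n

variable {D}

theorem prefixCode_eq_iff {z w : ℕ → Bool} {m n : ℕ} :
    prefixCode D z m = prefixCode D w n ↔ m = n ∧ ∀ i < n, i ∉ D → z i = w i := by
  simp only [prefixCode, Prod.mk.injEq]
  refine and_congr_right ?_
  rintro rfl
  simp only [Finset.ext_iff, Finset.mem_filter, Finset.mem_range]
  refine forall_congr' fun i => ?_
  by_cases h1 : i < m <;> by_cases h2 : i ∈ D <;> cases z i <;> cases w i <;>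
    simp [h1, h2]

theorem scramble_of_notMem {ω : ℕ × Finset ℕ → Bool} {z : ℕ → Bool} {n : ℕ} (hn : n ∉ D) :
    scramble D ω z n = z n := if_neg hn

theorem scramble_of_mem {ω : ℕ × Finset ℕ → Bool} {z : ℕ → Bool} {n : ℕ} (hn : n ∈ D) :
    scramble D ω z n = ω (prefixCode D z n) := if_pos hn

theorem scramble_congr {ω : ℕ × Finset ℕ → Bool} {z w : ℕ → Bool} (h : ∀ i ∉ D, z i = w i) :
    scramble D ω z = scramble D ω w := by
  ext n
  by_cases hn : n ∈ D
  · rw [scramble_of_mem hn, scramble_of_mem hn,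
      prefixCode_eq_iff.2 ⟨rfl, fun i _ => h i⟩]
  · rw [scramble_of_notMem hn, scramble_of_notMem hn, h n hn]

theorem continuous_scramble :
    Continuous fun p : (ℕ × Finset ℕ → Bool) × (ℕ → Bool) => scramble D p.1 p.2 := by
  refine continuous_pi fun n => ?_
  by_cases hn : n ∈ D
  · simp only [scramble_of_mem hn]
    refine continuous_iff_continuousAt.2 fun p => ?_
    have hp : ∀ᶠ q : (ℕ × Finset ℕ → Bool) × (ℕ → Bool) in 𝓝 p,
        ∀ i ∈ Finset.range n, q.2 i = p.2 i := by
      refine (Finset.eventually_all _).2 fun i _ => ?_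
      have : Continuous fun q : (ℕ × Finset ℕ → Bool) × (ℕ → Bool) => q.2 i := by fun_prop
      exact this.continuousAt.preimage_mem_nhds ((isOpen_discrete {p.2 i}).mem_nhds rfl)
    have hc : Continuous fun q : (ℕ × Finset ℕ → Bool) × (ℕ → Bool) =>
        q.1 (prefixCode D p.2 n) := by fun_prop
    refine hc.continuousAt.congr ?_
    filter_upwards [hp] with q hq
    rw [prefixCode_eq_iff.2 ⟨rfl, fun i hi _ => (hq i (Finset.mem_range.2 hi)).symm⟩]
  · simp only [scramble_of_notMem hn]
    fun_prop

theorem coinMeasure_scramble_cylinder_le (ω : ℕ × Finset ℕ → Bool) (n : ℕ) (x : ℕ → Bool) :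
    (coinMeasure ℕ).map (scramble D ω) {y | ∀ i < n, y i = x i} ≤
      (2 : ℝ≥0∞)⁻¹ ^ ((Finset.range n).filter (· ∉ D)).card := by
  have hm : Measurable (scramble D ω) :=
    (continuous_scramble.comp (Continuous.prodMk_right ω)).measurable
  have hms : MeasurableSet {y : ℕ → Bool | ∀ i < n, y i = x i} := by
    have : {y : ℕ → Bool | ∀ i < n, y i = x i} = Set.pi (Iio n) fun i => {x i} := by
      ext y; simp
    rw [this]
    exact .pi (to_countable _) fun i _ => measurableSet_singleton _
  rw [Measure.map_apply hm hms, ← coinMeasure_agree _ x]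
  refine measure_mono fun z hz i hi => ?_
  simp only [Finset.mem_filter, Finset.mem_range] at hi
  rw [← hz i hi.1, scramble_of_notMem hi.2]

variable (D) in
/-- The pairs `(z, ω)` such that some point of the range of `scramble D ω` other than
`scramble D ω z` is below `scramble D ω z`. -/
def scrambleBad (Q : (ℕ → Bool) → (ℕ → Bool) → Prop) :
    Set ((ℕ → Bool) × (ℕ × Finset ℕ → Bool)) :=
  {p | ∃ w, (∃ n ∉ D, w n ≠ p.1 n) ∧ Q (scramble D p.2 w) (scramble D p.2 p.1)}

variable {Q : (ℕ → Bool) → (ℕ → Bool) → Prop}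

theorem analyticSet_scrambleBad
    (hQ : MeasurableSet {p : (ℕ → Bool) × (ℕ → Bool) | Q p.1 p.2}) :
    AnalyticSet (scrambleBad D Q) := by
  have hproj : scrambleBad D Q = Prod.fst ''
      ({t : ((ℕ → Bool) × (ℕ × Finset ℕ → Bool)) × (ℕ → Bool) |
        ∃ n, n ∉ D ∧ t.2 n ≠ t.1.1 n} ∩
       (fun t : ((ℕ → Bool) × (ℕ × Finset ℕ → Bool)) × (ℕ → Bool) =>
        (scramble D t.1.2 t.2, scramble D t.1.2 t.1.1)) ⁻¹' {p | Q p.1 p.2}) := by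
    ext p
    constructor
    · rintro ⟨w, h1, h2⟩
      exact ⟨(p, w), ⟨h1, h2⟩, rfl⟩
    · rintro ⟨⟨_, w⟩, ⟨h1, h2⟩, rfl⟩
      exact ⟨w, h1, h2⟩
  rw [hproj]
  refine MeasurableSet.analyticSet_image (.inter ?_ ?_) measurable_fst
  · have : {t : ((ℕ → Bool) × (ℕ × Finset ℕ → Bool)) × (ℕ → Bool) |
        ∃ n, n ∉ D ∧ t.2 n ≠ t.1.1 n} = ⋃ n ∈ Dᶜ, {t | t.2 n = t.1.1 n}ᶜ := by
      ext t; simp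
    rw [this]
    refine .biUnion (to_countable _) fun n _ => .compl ?_
    exact measurableSet_eq_fun (by fun_prop) (by fun_prop)
  · have hc := continuous_scramble (D := D)
    have h1 : Continuous fun t : ((ℕ → Bool) × (ℕ × Finset ℕ → Bool)) × (ℕ → Bool) =>
        (scramble D t.1.2 t.2, scramble D t.1.2 t.1.1) :=
      (hc.comp (f := fun t : ((ℕ → Bool) × (ℕ × Finset ℕ → Bool)) × (ℕ → Bool) => (t.1.2, t.2))
        (by fun_prop)).prodMk
      (hc.comp (f := fun t : ((ℕ → Bool) × (ℕ × Finset ℕ → Bool)) × (ℕ → Bool) =>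
        (t.1.2, t.1.1)) (by fun_prop))
    exact h1.measurable hQ

/-- Resample the entries of `ω` outside the set `P` read by `z`: this preserves the law and leaves
the scrambled `z` unchanged, so only countably many candidates `x` need excluding. -/
theorem coinMeasure_scrambleBad_section (hD : D.Infinite)
    (hQ : MeasurableSet {p : (ℕ → Bool) × (ℕ → Bool) | Q p.1 p.2})
    (hc : ∀ y, {x | Q x y}.Countable) (z : ℕ → Bool) :
    coinMeasure (ℕ × Finset ℕ) (Prod.mk z ⁻¹' scrambleBad D Q) = 0 := by
  classical
  set Ω := ℕ × Finset ℕ → Bool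
  set P := range (prefixCode D z)
  have hmp := Measure.measurePreserving_piecewise_infinitePi
    (fun _ : ℕ × Finset ℕ => (PMF.uniformOfFintype Bool).toMeasure) P
  have hcont : Continuous fun p : Ω × Ω => P.piecewise p.1 p.2 := by
    refine continuous_pi fun i => ?_
    by_cases hi : i ∈ P
    · simp only [Set.piecewise, hi, if_true]; fun_prop
    · simp only [Set.piecewise, hi, if_false]; fun_prop
  have han : AnalyticSet (Prod.mk z ⁻¹' scrambleBad D Q) :=
    (analyticSet_scrambleBad hQ).preimage (Continuous.prodMk_right z)
  rw [coinMeasure, ← hmp.measure_preimage han.nullMeasurableSet]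
  refine Measure.prod_null_of_forall_section_null (han.preimage hcont).nullMeasurableSet
    fun α => ?_
  set y := scramble D α z with hy
  have hyβ : ∀ β : Ω, scramble D (P.piecewise α β) z = y := by
    intro β
    ext n
    by_cases hn : n ∈ D
    · rw [hy, scramble_of_mem hn, scramble_of_mem hn,
        Set.piecewise_eq_of_mem _ _ _ (mem_range_self n)]
    · rw [hy, scramble_of_notMem hn, scramble_of_notMem hn]
  refine measure_mono_null (t := ⋃ x ∈ {x | Q x y},
    {β : Ω | (∃ n ∉ D, x n ≠ z n) ∧ ∀ n ∈ D, P.piecewise α β (prefixCode D x n) = x n}) ?_ ?_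
  · rintro β ⟨w, ⟨n, hnD, hn⟩, hw⟩
    simp only [hyβ] at hw
    refine mem_biUnion hw ⟨⟨n, hnD, by rwa [scramble_of_notMem hnD]⟩, fun m hm => ?_⟩
    rw [scramble_of_mem hm, prefixCode_eq_iff.2 ⟨rfl, fun i _ hi => scramble_of_notMem hi⟩]
  · refine (measure_biUnion_null_iff (hc y)).2 fun x _ => ?_
    by_cases hx : ∃ n ∉ D, x n ≠ z n
    · obtain ⟨n, hnD, hn⟩ := hx
      have hinj : Function.Injective (prefixCode D x) := fun a b h => (prefixCode_eq_iff.1 h).1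
      have hinf : (prefixCode D x '' (D \ Iic n)).Infinite :=
        (hD.sdiff (finite_Iic n)).image hinj.injOn
      refine measure_mono_null ?_
        (coinMeasure_agree_infinite hinf fun i => x i.1)
      rintro β ⟨-, hβ⟩ _ ⟨m, ⟨hmD, hmn⟩, rfl⟩
      -- A code beyond position `n` records the bit where `x` and `z` differ, so `z` never reads
      -- that entry.
      have hnot : prefixCode D x m ∉ P := by
        rintro ⟨k, hk⟩
        exact hn ((prefixCode_eq_iff.1 hk).2 n (not_le.1 hmn) hnD).symm
      have := hβ m hmD
      rwa [Set.piecewise_eq_of_notMem _ _ _ hnot] at this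
    · simp only [hx, false_and]
      exact measure_empty

theorem exists_scramble_antichain (hD : D.Infinite)
    (hQ : MeasurableSet {p : (ℕ → Bool) × (ℕ → Bool) | Q p.1 p.2})
    (hc : ∀ y, {x | Q x y}.Countable) :
    ∃ ω : ℕ × Finset ℕ → Bool, ∃ B : Set (ℕ → Bool), IsClosed B ∧ IsAntichain Q B ∧
      (coinMeasure ℕ).map (scramble D ω) B ≠ 0 := by
  have hnull : ((coinMeasure ℕ).prod (coinMeasure (ℕ × Finset ℕ))) (scrambleBad D Q) = 0 :=
    Measure.prod_null_of_forall_section_null (analyticSet_scrambleBad hQ).nullMeasurableSet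
      (coinMeasure_scrambleBad_section hD hQ hc)
  have hae : ∀ᵐ p ∂(coinMeasure (ℕ × Finset ℕ)).prod (coinMeasure ℕ), p.swap ∉ scrambleBad D Q :=
    (Measure.measurePreserving_swap (μ := coinMeasure (ℕ × Finset ℕ))
      (ν := coinMeasure ℕ)).quasiMeasurePreserving.ae (measure_eq_zero_iff_ae_notMem.1 hnull)
  obtain ⟨ω, hω⟩ := (Measure.ae_ae_of_ae_prod hae).exists
  have hcont : Continuous (scramble D ω) :=
    continuous_scramble.comp (Continuous.prodMk_right ω)
  obtain ⟨N, hNω, hN, hN0⟩ := exists_measurable_superset_of_null (ae_iff.1 hω)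
  have hNpos : 0 < coinMeasure ℕ Nᶜ := by
    rw [(prob_compl_eq_one_iff hN).2 hN0]
    exact zero_lt_one
  obtain ⟨K, hKN, hK, hKpos⟩ := hN.compl.exists_lt_isCompact hNpos
  have hB := hK.image hcont
  refine ⟨ω, scramble D ω '' K, hB.isClosed, ?_, ?_⟩
  -- Distinct images come from points differing off `D`, so a comparability would make `z` bad.
  · rintro _ ⟨w, hw, rfl⟩ _ ⟨z, hz, rfl⟩ hne hwz
    refine hKN hz (hNω (not_not.2 ⟨w, ?_, hwz⟩))
    by_contra! h
    exact hne (scramble_congr h)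
  · rw [Measure.map_apply hcont.measurable hB.isClosed.measurableSet]
    exact (hKpos.trans_le (measure_mono (subset_preimage_image _ _))).ne'

end Scramble

/-! ### Density of the squares and conclusion -/

theorem card_filter_isSquare_le (n : ℕ) :
    ((Finset.range n).filter fun i => IsSquare i).card ≤ Nat.sqrt n + 1 := by
  refine (Finset.card_le_card (t := (Finset.range (Nat.sqrt n + 1)).image fun k => k * k)
    fun i hi => ?_).trans (Finset.card_image_le.trans_eq (Finset.card_range _))
  obtain ⟨h1, k, rfl⟩ := Finset.mem_filter.1 hi
  refine Finset.mem_image.2 ⟨k, Finset.mem_range.2 (Nat.lt_succ_of_le ?_), rfl⟩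
  exact Nat.le_sqrt.2 (Finset.mem_range.1 h1).le

theorem exists_forall_mul_le_card_filter_not_isSquare {s : ℝ} (hs : s < 1) :
    ∃ N : ℕ, ∀ n ≥ N, n * s ≤ ((Finset.range n).filter fun i => ¬ IsSquare i).card := by
  obtain ⟨M, hM⟩ := exists_nat_gt (2 / (1 - s))
  -- With `q = Nat.sqrt n ≥ M + 1`, there are at most `q + 1 ≤ 2 * q ≤ n * (1 - s)` squares below
  -- `n`.
  refine ⟨(M + 1) ^ 2, fun n hn => ?_⟩
  have h1 := Finset.card_filter_add_card_filter_not (s := Finset.range n) (fun i => IsSquare i)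
  rw [Finset.card_range] at h1
  have h2 := card_filter_isSquare_le n
  have h3 : M + 1 ≤ Nat.sqrt n := Nat.le_sqrt'.2 hn
  have h4 : Nat.sqrt n * Nat.sqrt n ≤ n := Nat.sqrt_le n
  have hM' : 2 < M * (1 - s) := (div_lt_iff₀ (by linarith)).1 hM
  set q := Nat.sqrt n
  have h1' : (((Finset.range n).filter fun i => IsSquare i).card : ℝ) +
    ((Finset.range n).filter fun i => ¬ IsSquare i).card = n := by exact_mod_cast h1
  have h2' : (((Finset.range n).filter fun i => IsSquare i).card : ℝ) ≤ q + 1 := by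
    exact_mod_cast h2
  have h3' : (M : ℝ) + 1 ≤ q := by exact_mod_cast h3
  have h4' : (q : ℝ) * q ≤ n := by exact_mod_cast h4
  have hM0 : (0 : ℝ) ≤ M := M.cast_nonneg
  have h5 : 2 ≤ q * (1 - s) := hM'.le.trans (by gcongr; linarith)
  have h6 : 2 * (q : ℝ) ≤ n * (1 - s) := calc
    2 * (q : ℝ) ≤ (q * (1 - s)) * q := by gcongr
    _ = (q * q) * (1 - s) := by ring
    _ ≤ n * (1 - s) := by gcongr
  linarith

theorem corollary3p4 (Q : (ℕ → Bool) → (ℕ → Bool) → Prop)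
    (hQ : IsLocallyCountableBorelQuasiOrder Q) :
    ∃ B : Set (ℕ → Bool), IsClosed B ∧ IsAntichain Q B ∧ dimH B = 1 := by
  classical
  have hD : {n : ℕ | IsSquare n}.Infinite :=
    infinite_of_injective_forall_mem (f := fun k : ℕ => k * k)
      (fun a b h => Nat.mul_self_inj.1 h) fun k => ⟨k, rfl⟩
  obtain ⟨ω, B, hBc, hBa, hB⟩ := exists_scramble_antichain hD hQ.borel hQ.locallyCountable
  refine ⟨B, hBc, hBa, le_antisymm (dimH_cantor_le_one B) ?_⟩
  refine le_of_forall_lt fun c hc => ?_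
  obtain ⟨s, hcs, hs1⟩ := ENNReal.lt_iff_exists_nnreal_btwn.1 hc
  refine hcs.trans_le ?_
  have hs0 : 0 < s := by exact_mod_cast (zero_le (a := c)).trans_lt hcs
  obtain ⟨N, hN⟩ := exists_forall_mul_le_card_filter_not_isSquare (s := s)
    (by exact_mod_cast hs1)
  refine le_dimH_of_measure_cylinder_le hB hs0 (N := N) fun n hn x => ?_
  refine (coinMeasure_scramble_cylinder_le ω n x).trans ?_
  rw [← ENNReal.rpow_natCast, ← ENNReal.rpow_natCast, ← ENNReal.rpow_mul]
  exact ENNReal.rpow_le_rpow_of_exponent_ge (by norm_num) (by simpa using hN n hn)
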